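/- Let $k\ge 1$ and let $\alpha,A,\beta_1,\dots,\beta_k,B_1,\dots,B_k$ be nonnegative real numbers with $\alpha>0$ and $\sum_{j=1}^k B_j>0$. Consider the $k$-th order rational difference equation $$x_n=\frac{\alpha+\sum_{i=1}^k\beta_i x_{n-i}}{A+\sum_{j=1}^k B_j x_{n-j}},\qquad n\in\mathbb N,$$ where a solution is always understood to have nonnegative initial conditions (its first $k$ terms) for which the denominator never vanishes, and an equilibrium is a nonnegative constant solution. Let $I_\beta=\{i\in\{1,\dots,k\}:\beta_i>0\}$, $I_B=\{j\in\{1,\dots,k\}:B_j>0\}$ and $g=\gcd(I_\beta\cup I_B)$. Assume that $2g\mid i$ for all $i\in I_\beta$ and $2g\mid j+g$ for all $j\in I_B$. Then: (i) If $A>\sum_{i=1}^k\beta_i$, there is a unique equilibrium, and it is globally asymptotically stable (that is, it is Lyapunov stable and every solution converges to it). (ii) If $A=\sum_{i=1}^k\beta_i$, every solution converges to a periodic solution of (not necessarily prime) period $2g$ (that is, its difference from such a solution of the equation tends to $0$), and there exist periodic solutions of prime (minimal) period $2g$. (iii) If $A<\sum_{i=1}^k\beta_i$, then there exist initial conditions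 for which the solution is unbounded. -/

import Mathlib

open Filter Topology

namespace RationalDiff

/-- The set `I_c` of those indices `i ∈ {1, …, k}` for which the coefficient `c i` is positive. -/
noncomputable def posIndices (k : ℕ) (c : ℕ → ℝ) : Finset ℕ :=
  (Finset.Icc 1 k).filter (fun i => 0 < c i)

/-- The greatest common divisor of `I_β ∪ I_B`. -/
noncomputable def delayGcd (k : ℕ) (β B : ℕ → ℝ) : ℕ :=
  (posIndices k β ∪ posIndices k B).gcd id

/-- `x` is a solution of `x_n = (α + ∑ β_i x_{n-i}) / (A + ∑ B_j x_{n-j})` with nonnegative initial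
conditions for which the denominator never vanishes. The indices are shifted so that the `k`
initial conditions are `x 0, …, x (k - 1)`, and the equation determines `x (n + k)` for every
natural number `n`. -/
structure IsSolution (k : ℕ) (α A : ℝ) (β B : ℕ → ℝ) (x : ℕ → ℝ) : Prop where
  init_nonneg : ∀ n, n < k → 0 ≤ x n
  denom_ne_zero : ∀ n, A + ∑ j ∈ Finset.Icc 1 k, B j * x (n + k - j) ≠ 0
  recurrence : ∀ n, x (n + k) =
    (α + ∑ i ∈ Finset.Icc 1 k, β i * x (n + k - i)) /
      (A + ∑ j ∈ Finset.Icc 1 k, B j * x (n + k - j))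

/-- `e` is a (nonnegative) equilibrium of the difference equation. -/
def IsEquilibrium (k : ℕ) (α A : ℝ) (β B : ℕ → ℝ) (e : ℝ) : Prop :=
  0 ≤ e ∧ A + ∑ j ∈ Finset.Icc 1 k, B j * e ≠ 0 ∧
    e = (α + ∑ i ∈ Finset.Icc 1 k, β i * e) / (A + ∑ j ∈ Finset.Icc 1 k, B j * e)

/-- (Lyapunov) stability of `e`: solutions whose initial conditions are close enough to `e` stay
close to `e`. -/
def IsLocallyStable (k : ℕ) (α A : ℝ) (β B : ℕ → ℝ) (e : ℝ) : Prop :=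
  ∀ ε > 0, ∃ δ > 0, ∀ x : ℕ → ℝ, IsSolution k α A β B x →
    (∀ n, n < k → |x n - e| < δ) → ∀ n, |x n - e| < ε

/-- Every solution converges to `e`. -/
def IsGlobalAttractor (k : ℕ) (α A : ℝ) (β B : ℕ → ℝ) (e : ℝ) : Prop :=
  ∀ x : ℕ → ℝ, IsSolution k α A β B x → Tendsto x atTop (𝓝 e)

/-- Global asymptotic stability: stability together with global attractivity. -/
def IsGloballyAsymptoticallyStable (k : ℕ) (α A : ℝ) (β B : ℕ → ℝ) (e : ℝ) : Prop :=
  IsLocallyStable k α A β B e ∧ IsGlobalAttractor k α A β B e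

/-- `p` is a (not necessarily prime) period of the sequence `x`. -/
def HasPeriod (x : ℕ → ℝ) (p : ℕ) : Prop :=
  0 < p ∧ ∀ n, x (n + p) = x n

/-- `p` is the prime period of the sequence `x`: its smallest period. -/
def HasPrimePeriod (x : ℕ → ℝ) (p : ℕ) : Prop :=
  IsLeast {q : ℕ | HasPeriod x q} p

end RationalDiff

/-!
Write `b = ∑ β i` and `s = ∑ B j`, so that an equilibrium is a nonnegative root of
`e (A + s e) = α + b e`.

* If `b < A`, the limits superior `S` and inferior `I` of a solution satisfy
  `S (A + s I) ≤ α + b S` and `α + b I ≤ I (A + s S)`. Hence `(A - b) S ≤ (A - b) I`, so the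
  solution converges, and its limit is the root `e`. Close to `e`, the recurrence does not increase
  the largest distance to `e`, which gives stability.

* Put `g = gcd (I_β ∪ I_B)` and split `ℕ` into the two phases `n / g` even and `n / g` odd. The
  divisibility hypotheses say that delays in `I_β` preserve the phase and residue class modulo `g`,
  and that delays in `I_B` change the phase and preserve the residue class.

* If `A = b`, put `c = α / s` and let `u n` be `x n` in the even phase and `c / x n` in the odd
  phase. The recurrence then says that `u n` is a weighted mean of the `u (n - i)`,
  `i ∈ I_β ∪ I_B`, with positive weights (`IsSolution.averages`), which are bounded below since
  intervals `[m, M]` with `m M = c` are invariant (`IsSolution.exists_bounds`). As the delays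
  generate all large multiples of `g`, such a sequence converges along every residue class modulo
  `g` (`Averages.exists_tendsto_residue`). Undoing the substitution, `x` approaches a sequence with
  `y n * y (n + g) = c`, and the positive sequences of this kind that have period `2g` are
  solutions.

* If `A < b`, initial conditions that are large in the even phase and small in the odd phase lead to
  geometric growth in the even phase (`exists_unbounded_solution`).
-/

open Filter Topology

namespace RationalDiff

/-! ### Sequences that average their past -/

/-- From `n₀` on, each term `v n` behaves like a weighted mean of the terms `v (n - j)`, `j ∈ J`,
with all weights at least `ε`. This order-theoretic form (`v n` is at least every common lower
bound of these terms, and it keeps a proportion `ε` of the distance of each of them to a common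
upper bound) is insensitive to a reindexing of `v`. -/
structure Averages (v : ℕ → ℝ) (J : Set ℕ) (ε : ℝ) (n₀ : ℕ) : Prop where
  upper : ∀ n, n₀ ≤ n → ∀ a, (∀ j ∈ J, v (n - j) ≤ a) → ∀ j ∈ J, ε * (a - v (n - j)) ≤ a - v n
  lower : ∀ n, n₀ ≤ n → ∀ a, (∀ j ∈ J, a ≤ v (n - j)) → a ≤ v n

theorem Averages.le_of_window_le {v : ℕ → ℝ} {J : Set ℕ} {ε : ℝ} {n₀ K : ℕ}
    (h : Averages v J ε n₀) (hε : 0 < ε) (hne : J.Nonempty) (hJ : ∀ j ∈ J, 0 < j ∧ j ≤ K)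
    {m₁ m₂ : ℕ} (hm : m₁ + K ≤ m₂) (hm₂ : n₀ ≤ m₂) {a : ℝ}
    (hw : ∀ i, m₁ ≤ i → i < m₂ → v i ≤ a) : ∀ i, m₁ ≤ i → v i ≤ a := by
  intro i
  induction i using Nat.strong_induction_on with
  | _ i ih =>
    intro hi
    by_cases hlt : i < m₂
    · exact hw i hi hlt
    have hpast : ∀ j ∈ J, v (i - j) ≤ a := fun j hj => by
      have := hJ j hj
      exact ih (i - j) (by omega) (by omega)
    obtain ⟨j, hj⟩ := hne
    have h1 := h.upper i (by omega) a hpast j hj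
    have h2 := mul_nonneg hε.le (sub_nonneg.2 (hpast j hj))
    linarith

theorem Averages.ge_of_window_ge {v : ℕ → ℝ} {J : Set ℕ} {ε : ℝ} {n₀ K : ℕ}
    (h : Averages v J ε n₀) (hJ : ∀ j ∈ J, 0 < j ∧ j ≤ K)
    {m₁ m₂ : ℕ} (hm : m₁ + K ≤ m₂) (hm₂ : n₀ ≤ m₂) {a : ℝ}
    (hw : ∀ i, m₁ ≤ i → i < m₂ → a ≤ v i) : ∀ i, m₁ ≤ i → a ≤ v i := by
  intro i
  induction i using Nat.strong_induction_on with
  | _ i ih =>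
    intro hi
    by_cases hlt : i < m₂
    · exact hw i hi hlt
    refine h.lower i (by omega) a fun j hj => ?_
    have := hJ j hj
    exact ih (i - j) (by omega) (by omega)

/-- If `v n` is close to an upper bound of the past, so is `v (n - s)` for every `s` in the
semigroup generated by `J`. -/
theorem Averages.exists_past_close {v : ℕ → ℝ} {J : Set ℕ} {ε : ℝ} {n₀ K : ℕ}
    (h : Averages v J ε n₀) (hε : 0 < ε) (hJ : ∀ j ∈ J, 0 < j ∧ j ≤ K) {s : ℕ}
    (hs : s ∈ AddSubmonoid.closure J) :
    ∃ C > 0, ∀ a T n, n₀ ≤ T → (∀ i, T ≤ i → v i ≤ a) → T + s + K ≤ n →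
      a - v (n - s) ≤ C * (a - v n) := by
  induction hs using AddSubmonoid.closure_induction with
  | mem j hj =>
    refine ⟨ε⁻¹, inv_pos.2 hε, fun a T n hT ha hn => ?_⟩
    have := h.upper n (by omega) a (fun i hi => ha _ (by have := hJ i hi; omega)) j hj
    rwa [inv_mul_eq_div, le_div_iff₀ hε, mul_comm]
  | zero => exact ⟨1, one_pos, fun a T n _ _ _ => by simp⟩
  | add s t _ _ hs ht =>
    obtain ⟨C, hC, hs⟩ := hs
    obtain ⟨D, hD, ht⟩ := ht
    refine ⟨D * C, mul_pos hD hC, fun a T n hT ha hn => ?_⟩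
    have h1 := hs a T n hT ha (by omega)
    have h2 := ht a T (n - s) hT ha (by omega)
    rw [Nat.sub_sub] at h2
    calc _ ≤ _ := h2
      _ ≤ D * (C * (a - v n)) := mul_le_mul_of_nonneg_left h1 hD.le
      _ = _ := by ring

/-- A sequence averaging its past over a set of delays with greatest common divisor `1`
converges. Where a term comes close to the limit superior, so does a full window of terms before
it, since the semigroup generated by the delays contains all large integers; from there on no term
is much smaller. -/
theorem Averages.exists_tendsto {v : ℕ → ℝ} {J : Set ℕ} {ε : ℝ} {n₀ K : ℕ}
    (h : Averages v J ε n₀) (hε : 0 < ε) (hJ : ∀ j ∈ J, 0 < j ∧ j ≤ K)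
    (hgcd : ∀ d, (∀ j ∈ J, d ∣ j) → d = 1) : ∃ L, Tendsto v atTop (𝓝 L) := by
  have hne : J.Nonempty := by
    by_contra hJe
    have := hgcd 2 fun j hj => (hJe ⟨j, hj⟩).elim
    omega
  obtain ⟨C₁, hC₁⟩ := ((Finset.range (n₀ + K)).image v).exists_le
  obtain ⟨C₂, hC₂⟩ := ((Finset.range (n₀ + K)).image v).bddBelow
  have hup : ∀ i, v i ≤ C₁ := fun i =>
    h.le_of_window_le hε hne hJ (m₁ := 0) (m₂ := n₀ + K) (by omega) (by omega)
      (fun i _ hi => hC₁ _ (Finset.mem_image_of_mem _ (Finset.mem_range.2 hi))) i (Nat.zero_le _)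
  have hlo : ∀ i, C₂ ≤ v i := fun i =>
    h.ge_of_window_ge hJ (m₁ := 0) (m₂ := n₀ + K) (by omega) (by omega)
      (fun i _ hi => hC₂ (Finset.mem_image_of_mem _ (Finset.mem_range.2 hi))) i (Nat.zero_le _)
  have hbdd : IsBoundedUnder (· ≤ ·) atTop v := isBoundedUnder_of ⟨C₁, hup⟩
  have hbdd' : IsBoundedUnder (· ≥ ·) atTop v := isBoundedUnder_of ⟨C₂, hlo⟩
  obtain ⟨N, hN⟩ := Nat.exists_mem_closure_of_ge J
  have hone : Nat.setGcd J = 1 := hgcd _ fun j hj => Nat.setGcd_dvd_of_mem hj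
  have hcl : ∀ s, N ≤ s → s ∈ AddSubmonoid.closure J := fun s hs =>
    hN s hs (by rw [hone]; exact one_dvd s)
  choose C hCpos hC using fun s (hs : N ≤ s) => h.exists_past_close hε hJ (hcl s hs)
  obtain ⟨M, hM⟩ := ((Finset.range (K + 1)).image fun t => C (N + t) (by omega)).exists_le
  have hM' : ∀ s (hs : N ≤ s), s ≤ N + K → C s hs ≤ M := fun s hs hs' => by
    refine hM _ (Finset.mem_image.2 ⟨s - N, Finset.mem_range.2 (by omega), ?_⟩)
    congr 1
    omega
  have hMpos : 0 < M := (hCpos N le_rfl).trans_le (hM' N le_rfl (by omega))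
  refine ⟨limsup v atTop, tendsto_order.2
    ⟨fun b hb => ?_, fun b hb => eventually_lt_of_limsup_lt hb⟩⟩
  set S := limsup v atTop with hS
  obtain ⟨b', hbb', hb'S⟩ := exists_between hb
  have hδ : 0 < (S - b') / (2 * M) := by
    have := sub_pos.2 hb'S
    positivity
  set δ := (S - b') / (2 * M) with hδdef
  have hMδ : M * (2 * δ) = S - b' := by rw [hδdef]; field_simp
  obtain ⟨T, hT⟩ := eventually_atTop.1
    (eventually_lt_of_limsup_lt (show limsup v atTop < S + δ by linarith) hbdd)
  obtain ⟨n, hnT, hn⟩ := frequently_atTop.1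
    (frequently_lt_of_lt_limsup hbdd'.isCoboundedUnder_le (show S - δ < limsup v atTop by linarith))
    (n₀ + T + (N + K) + K)
  have key : ∀ i, n - (N + K) ≤ i → i < n - N → b' ≤ v i := by
    intro i hi hi'
    have h1 := hC (n - i) (by omega) (S + δ) (n₀ + T) n (by omega)
      (fun i hi => (hT i (by omega)).le) (by omega)
    rw [Nat.sub_sub_self (by omega)] at h1
    have h2 : C (n - i) (by omega) * (S + δ - v n) ≤ M * (2 * δ) :=
      mul_le_mul (hM' _ _ (by omega)) (by linarith)
        (by have := hT n (by omega); linarith) hMpos.le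
    linarith
  refine eventually_atTop.2 ⟨n - (N + K), fun i hi => hbb'.trans_le ?_⟩
  exact h.ge_of_window_ge hJ (m₂ := n - N) (by omega) (by omega) key i hi

/-- Along each residue class modulo the greatest common divisor `g` of the delays, a sequence
averaging its past converges. -/
theorem Averages.exists_tendsto_residue {u : ℕ → ℝ} {J : Set ℕ} {ε : ℝ} {n₀ K g : ℕ}
    (h : Averages u J ε n₀) (hε : 0 < ε) (hJ : ∀ j ∈ J, 0 < j ∧ j ≤ K) (hg : 0 < g)
    (hdvd : ∀ j ∈ J, g ∣ j) (hgcd : ∀ d, (∀ j ∈ J, d ∣ j) → d ∣ g) (hK : K ≤ n₀) (r : ℕ) :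
    ∃ L, Tendsto (fun t => u (r + g * t)) atTop (𝓝 L) := by
  have hsub : ∀ t j, g * j ∈ J → n₀ ≤ t → r + g * (t - j) = r + g * t - g * j := by
    intro t j hj ht
    have h1 := (hJ _ hj).2
    have h2 : t ≤ g * t := Nat.le_mul_of_pos_left t hg
    rw [Nat.mul_sub]
    omega
  have hn : ∀ t, n₀ ≤ t → n₀ ≤ r + g * t := fun t ht => by
    have h2 : t ≤ g * t := Nat.le_mul_of_pos_left t hg
    omega
  have hall : ∀ (t : ℕ) (P : ℝ → Prop), n₀ ≤ t →
      (∀ j ∈ {j | g * j ∈ J}, P (u (r + g * (t - j)))) → ∀ j ∈ J, P (u (r + g * t - j)) := by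
    intro t P ht hP j hj
    obtain ⟨j, rfl⟩ := hdvd j hj
    rw [← hsub t j hj ht]
    exact hP j hj
  have hav : Averages (fun t => u (r + g * t)) {j | g * j ∈ J} ε n₀ := by
    refine ⟨fun t ht a ha j hj => ?_, fun t ht a ha => ?_⟩
    · have := h.upper _ (hn t ht) a (hall t (· ≤ a) ht ha) _ hj
      simpa only [hsub t j hj ht] using this
    · exact h.lower _ (hn t ht) a (hall t (a ≤ ·) ht ha)
  refine hav.exists_tendsto (K := K) hε (fun j hj => ?_) fun d hd => ?_
  · have h1 := hJ _ hj
    have h2 : j ≤ g * j := Nat.le_mul_of_pos_left j hg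
    exact ⟨Nat.pos_of_mul_pos_left h1.1, h2.trans h1.2⟩
  · have : g * d ∣ g := hgcd _ fun j hj => by
      obtain ⟨j, rfl⟩ := hdvd j hj
      exact mul_dvd_mul_left g (hd j hj)
    have : g * d ∣ g * 1 := by simpa using this
    exact Nat.dvd_one.1 (Nat.dvd_of_mul_dvd_mul_left hg this)

/-- A mean with nonnegative weights, of which those on `J` are at least `w` and the total is at
most `W`, averages over `J`. -/
theorem averages_of_weights {u : ℕ → ℝ} {p : ℕ → ℕ → ℝ} {k n₀ : ℕ} {J : Set ℕ} {w W : ℝ}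
    (hw : 0 < w) (hJk : ∀ j ∈ J, j ∈ Finset.Icc 1 k) (hne : J.Nonempty)
    (hp : ∀ n, n₀ ≤ n → ∀ i ∈ Finset.Icc 1 k, 0 ≤ p n i)
    (hp0 : ∀ n, n₀ ≤ n → ∀ i ∈ Finset.Icc 1 k, i ∉ J → p n i = 0)
    (hpJ : ∀ n, n₀ ≤ n → ∀ j ∈ J, w ≤ p n j)
    (hpW : ∀ n, n₀ ≤ n → ∑ i ∈ Finset.Icc 1 k, p n i ≤ W)
    (hu : ∀ n, n₀ ≤ n →
      u n * ∑ i ∈ Finset.Icc 1 k, p n i = ∑ i ∈ Finset.Icc 1 k, p n i * u (n - i)) :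
    Averages u J (w / W) n₀ := by
  have hpos : ∀ n, n₀ ≤ n → 0 < ∑ i ∈ Finset.Icc 1 k, p n i := fun n hn => by
    obtain ⟨j, hj⟩ := hne
    exact (hw.trans_le (hpJ n hn j hj)).trans_le
      (Finset.single_le_sum (fun i hi => hp n hn i hi) (hJk j hj))
  refine ⟨fun n hn a ha j hj => ?_, fun n hn a ha => ?_⟩
  · have hterm : ∀ i ∈ Finset.Icc 1 k, 0 ≤ p n i * (a - u (n - i)) := fun i hi => by
      by_cases hiJ : i ∈ J
      · exact mul_nonneg (hp n hn i hi) (sub_nonneg.2 (ha i hiJ))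
      · rw [hp0 n hn i hi hiJ, zero_mul]
    have h1 : p n j * (a - u (n - j)) ≤ (a - u n) * ∑ i ∈ Finset.Icc 1 k, p n i := by
      calc _ ≤ ∑ i ∈ Finset.Icc 1 k, p n i * (a - u (n - i)) :=
            Finset.single_le_sum hterm (hJk j hj)
        _ = _ := by
            rw [sub_mul, hu n hn, Finset.mul_sum, ← Finset.sum_sub_distrib]
            exact Finset.sum_congr rfl fun i _ => by ring
    have h0 : 0 ≤ a - u (n - j) := sub_nonneg.2 (ha j hj)
    have h2 : w * (a - u (n - j)) ≤ (a - u n) * ∑ i ∈ Finset.Icc 1 k, p n i :=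
      (mul_le_mul_of_nonneg_right (hpJ n hn j hj) h0).trans h1
    have h3 : 0 ≤ a - u n :=
      nonneg_of_mul_nonneg_left ((mul_nonneg hw.le h0).trans h2) (hpos n hn)
    have hW : 0 < W := (hpos n hn).trans_le (hpW n hn)
    rw [div_mul_eq_mul_div, div_le_iff₀ hW]
    exact h2.trans (mul_le_mul_of_nonneg_left (hpW n hn) h3)
  · have h1 : a * ∑ i ∈ Finset.Icc 1 k, p n i ≤ u n * ∑ i ∈ Finset.Icc 1 k, p n i := by
      rw [hu n hn, Finset.mul_sum]
      refine Finset.sum_le_sum fun i hi => ?_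
      by_cases hiJ : i ∈ J
      · rw [mul_comm]
        exact mul_le_mul_of_nonneg_left (ha i hiJ) (hp n hn i hi)
      · rw [hp0 n hn i hi hiJ]; simp
    exact le_of_mul_le_mul_right h1 (hpos n hn)


/-! ### Solutions of the difference equation -/

theorem sum_mul_le_of_pos {s : Finset ℕ} {c f : ℕ → ℝ} {M : ℝ} (hc : ∀ i ∈ s, 0 ≤ c i)
    (hf : ∀ i ∈ s, 0 < c i → f i ≤ M) : ∑ i ∈ s, c i * f i ≤ (∑ i ∈ s, c i) * M := by
  rw [Finset.sum_mul]
  refine Finset.sum_le_sum fun i hi => ?_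
  rcases (hc i hi).eq_or_lt with h | h
  · simp [← h]
  · exact mul_le_mul_of_nonneg_left (hf i hi h) h.le

theorem le_sum_mul_of_pos {s : Finset ℕ} {c f : ℕ → ℝ} {m : ℝ} (hc : ∀ i ∈ s, 0 ≤ c i)
    (hf : ∀ i ∈ s, 0 < c i → m ≤ f i) : (∑ i ∈ s, c i) * m ≤ ∑ i ∈ s, c i * f i := by
  rw [Finset.sum_mul]
  refine Finset.sum_le_sum fun i hi => ?_
  rcases (hc i hi).eq_or_lt with h | h
  · simp [← h]
  · exact mul_le_mul_of_nonneg_left (hf i hi h) h.le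

theorem mem_posIndices {k : ℕ} {c : ℕ → ℝ} {i : ℕ} :
    i ∈ posIndices k c ↔ i ∈ Finset.Icc 1 k ∧ 0 < c i := Finset.mem_filter

theorem posIndices_nonempty {k : ℕ} {c : ℕ → ℝ} (h : 0 < ∑ i ∈ Finset.Icc 1 k, c i) :
    (posIndices k c).Nonempty := by
  by_contra hne
  refine h.not_ge (Finset.sum_nonpos fun i hi => not_lt.1 fun hpos => hne ⟨i, ?_⟩)
  exact mem_posIndices.2 ⟨hi, hpos⟩

section Basic

variable {k : ℕ} {α A : ℝ} {β B : ℕ → ℝ} {x : ℕ → ℝ}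

theorem IsSolution.nonneg (hx : IsSolution k α A β B x) (hα : 0 < α) (hA : 0 ≤ A)
    (hβ : ∀ i ∈ Finset.Icc 1 k, 0 ≤ β i) (hB : ∀ j ∈ Finset.Icc 1 k, 0 ≤ B j) (n : ℕ) :
    0 ≤ x n := by
  induction n using Nat.strong_induction_on with
  | _ n ih =>
    by_cases hn : n < k
    · exact hx.init_nonneg n hn
    obtain ⟨m, rfl⟩ : ∃ m, n = m + k := ⟨n - k, by omega⟩
    rw [hx.recurrence m]
    have hpast : ∀ i ∈ Finset.Icc 1 k, 0 ≤ x (m + k - i) := fun i hi => by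
      rw [Finset.mem_Icc] at hi
      exact ih _ (by omega)
    exact div_nonneg
      (add_nonneg hα.le (Finset.sum_nonneg fun i hi => mul_nonneg (hβ i hi) (hpast i hi)))
      (add_nonneg hA (Finset.sum_nonneg fun i hi => mul_nonneg (hB i hi) (hpast i hi)))

theorem IsSolution.denom_pos (hx : IsSolution k α A β B x) (hα : 0 < α) (hA : 0 ≤ A)
    (hβ : ∀ i ∈ Finset.Icc 1 k, 0 ≤ β i) (hB : ∀ j ∈ Finset.Icc 1 k, 0 ≤ B j) (n : ℕ) :
    0 < A + ∑ j ∈ Finset.Icc 1 k, B j * x (n + k - j) :=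
  (add_nonneg hA (Finset.sum_nonneg fun i hi =>
    mul_nonneg (hB i hi) (hx.nonneg hα hA hβ hB _))).lt_of_ne' (hx.denom_ne_zero n)

theorem IsSolution.mul_denom (hx : IsSolution k α A β B x) (n : ℕ) :
    x (n + k) * (A + ∑ j ∈ Finset.Icc 1 k, B j * x (n + k - j)) =
      α + ∑ i ∈ Finset.Icc 1 k, β i * x (n + k - i) := by
  rw [hx.recurrence n, div_mul_cancel₀ _ (hx.denom_ne_zero n)]

theorem IsSolution.pos (hx : IsSolution k α A β B x) (hα : 0 < α) (hA : 0 ≤ A)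
    (hβ : ∀ i ∈ Finset.Icc 1 k, 0 ≤ β i) (hB : ∀ j ∈ Finset.Icc 1 k, 0 ≤ B j) (n : ℕ) :
    0 < x (n + k) := by
  rw [hx.recurrence n]
  exact div_pos (add_pos_of_pos_of_nonneg hα (Finset.sum_nonneg fun i hi =>
    mul_nonneg (hβ i hi) (hx.nonneg hα hA hβ hB _))) (hx.denom_pos hα hA hβ hB n)

/-- The sequence with initial conditions `init 0, …, init (k - 1)` given by the recurrence. -/
noncomputable def solutionOf (k : ℕ) (α A : ℝ) (β B : ℕ → ℝ) (init : ℕ → ℝ) (n : ℕ) : ℝ :=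
  if n < k then init n else
    (α + ∑ i ∈ (Finset.Icc 1 k).attach, if _h : (i : ℕ) ≤ n then
        β i * solutionOf k α A β B init (n - i) else 0) /
      (A + ∑ j ∈ (Finset.Icc 1 k).attach, if _h : (j : ℕ) ≤ n then
        B j * solutionOf k α A β B init (n - j) else 0)
termination_by n
decreasing_by
  all_goals
    have := (Finset.mem_Icc.1 (Subtype.prop ‹_›)).1
    omega

theorem solutionOf_of_lt {init : ℕ → ℝ} {n : ℕ} (hn : n < k) :
    solutionOf k α A β B init n = init n := by
  rw [solutionOf, if_pos hn]

theorem solutionOf_add (init : ℕ → ℝ) (n : ℕ) :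
    solutionOf k α A β B init (n + k) =
      (α + ∑ i ∈ Finset.Icc 1 k, β i * solutionOf k α A β B init (n + k - i)) /
        (A + ∑ j ∈ Finset.Icc 1 k, B j * solutionOf k α A β B init (n + k - j)) := by
  have hsum : ∀ c : ℕ → ℝ, (∑ i ∈ (Finset.Icc 1 k).attach, if _h : (i : ℕ) ≤ n + k then
      c i * solutionOf k α A β B init (n + k - i) else 0) =
      ∑ i ∈ Finset.Icc 1 k, c i * solutionOf k α A β B init (n + k - i) := fun c => by
    rw [← Finset.sum_attach (Finset.Icc 1 k)]
    refine Finset.sum_congr rfl fun i _ => ?_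
    have := (Finset.mem_Icc.1 i.2).2
    rw [dif_pos (by omega)]
  conv_lhs => rw [solutionOf, if_neg (by omega), hsum, hsum]

theorem isSolution_solutionOf {init : ℕ → ℝ} (hα : 0 < α) (hA : 0 ≤ A)
    (hβ : ∀ i ∈ Finset.Icc 1 k, 0 ≤ β i) (hB : ∀ j ∈ Finset.Icc 1 k, 0 ≤ B j)
    (hBsum : 0 < ∑ j ∈ Finset.Icc 1 k, B j) (hinit : ∀ n, n < k → 0 < init n) :
    (∀ n, 0 < solutionOf k α A β B init n) ∧
      IsSolution k α A β B (solutionOf k α A β B init) := by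
  have hden : ∀ n, (∀ i ∈ Finset.Icc 1 k, 0 < solutionOf k α A β B init (n + k - i)) →
      0 < A + ∑ j ∈ Finset.Icc 1 k, B j * solutionOf k α A β B init (n + k - j) := fun n hn => by
    refine add_pos_of_nonneg_of_pos hA ?_
    obtain ⟨j, hj⟩ := posIndices_nonempty hBsum
    obtain ⟨hj, hBj⟩ := mem_posIndices.1 hj
    exact (mul_pos hBj (hn j hj)).trans_le
      (Finset.single_le_sum (f := fun j => B j * solutionOf k α A β B init (n + k - j))
        (fun i hi => mul_nonneg (hB i hi) (hn i hi).le) hj)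
  have hpos : ∀ n, 0 < solutionOf k α A β B init n := fun n => by
    induction n using Nat.strong_induction_on with
    | _ n ih =>
      by_cases hn : n < k
      · rw [solutionOf_of_lt hn]
        exact hinit n hn
      obtain ⟨m, rfl⟩ : ∃ m, n = m + k := ⟨n - k, by omega⟩
      have hpast : ∀ i ∈ Finset.Icc 1 k, 0 < solutionOf k α A β B init (m + k - i) :=
        fun i hi => by
          rw [Finset.mem_Icc] at hi
          exact ih _ (by omega)
      rw [solutionOf_add]
      exact div_pos (add_pos_of_pos_of_nonneg hα (Finset.sum_nonneg fun i hi =>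
        mul_nonneg (hβ i hi) (hpast i hi).le)) (hden m hpast)
  exact ⟨hpos, fun n _ => (hpos n).le, fun n => (hden n fun i _ => hpos _).ne',
    solutionOf_add init⟩

end Basic

/-! ### Global asymptotic stability -/

section Stable

variable {k : ℕ} {α A : ℝ} {β B : ℕ → ℝ}

/-- Equilibria are the nonnegative roots of `(∑ B) e² + (A - ∑ β) e - α`. -/
theorem isEquilibrium_iff (hα : 0 < α) (hA : 0 ≤ A) (hBsum : 0 < ∑ j ∈ Finset.Icc 1 k, B j)
    (e : ℝ) : IsEquilibrium k α A β B e ↔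
      0 ≤ e ∧ e * (A + (∑ j ∈ Finset.Icc 1 k, B j) * e) =
        α + (∑ i ∈ Finset.Icc 1 k, β i) * e := by
  unfold IsEquilibrium
  rw [← Finset.sum_mul, ← Finset.sum_mul]
  constructor
  · rintro ⟨h0, hne, h⟩
    exact ⟨h0, by rwa [eq_div_iff hne] at h⟩
  · rintro ⟨h0, h⟩
    have hepos : 0 < e := h0.lt_of_ne' (by rintro rfl; simp at h; exact hα.ne h)
    have hne : A + (∑ j ∈ Finset.Icc 1 k, B j) * e ≠ 0 := by positivity
    exact ⟨h0, hne, by rwa [eq_div_iff hne]⟩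

theorem exists_quadratic_root {α b A S : ℝ} (hα : 0 < α) (hS : 0 < S) (hb : b < A) :
    ∃ e, 0 < e ∧ e * (A + S * e) = α + b * e := by
  have hD : 0 ≤ (A - b) ^ 2 + 4 * S * α := by positivity
  refine ⟨(√((A - b) ^ 2 + 4 * S * α) - (A - b)) / (2 * S), ?_, ?_⟩
  · refine div_pos (sub_pos.2 (Real.lt_sqrt_of_sq_lt ?_)) (by positivity)
    have : 0 < 4 * S * α := by positivity
    linarith
  · have h := Real.sq_sqrt hD
    field_simp
    nlinarith

theorem quadratic_root_unique {α b A S e e' : ℝ} (hS : 0 < S) (hb : b < A) (he : 0 ≤ e)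
    (he' : 0 ≤ e') (h : e * (A + S * e) = α + b * e) (h' : e' * (A + S * e') = α + b * e') :
    e' = e := by
  have h1 : (e' - e) * ((A - b) + S * (e + e')) = 0 := by linear_combination h' - h
  have h2 : 0 < (A - b) + S * (e + e') :=
    add_pos_of_pos_of_nonneg (sub_pos.2 hb) (mul_nonneg hS.le (add_nonneg he he'))
  rcases mul_eq_zero.1 h1 with h3 | h3
  · linarith
  · exact absurd h3 h2.ne'

/-- Close to the equilibrium `e`, the recurrence does not increase the largest distance to `e`:
`(x n - e)` times the denominator equals `∑ β i (x (n - i) - e) - e ∑ B j (x (n - j) - e)`. -/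
theorem isLocallyStable_of_lt
    (hβ : ∀ i ∈ Finset.Icc 1 k, 0 ≤ β i) (hB : ∀ j ∈ Finset.Icc 1 k, 0 ≤ B j)
    (hBsum : 0 < ∑ j ∈ Finset.Icc 1 k, B j) (hlt : ∑ i ∈ Finset.Icc 1 k, β i < A) {e : ℝ}
    (he : 0 < e) (heq : e * (A + (∑ j ∈ Finset.Icc 1 k, B j) * e) =
      α + (∑ i ∈ Finset.Icc 1 k, β i) * e) :
    IsLocallyStable k α A β B e := by
  set b := ∑ i ∈ Finset.Icc 1 k, β i
  set S := ∑ j ∈ Finset.Icc 1 k, B j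
  intro ε hε
  refine ⟨min ε ((A - b) / S), lt_min hε (div_pos (sub_pos.2 hlt) hBsum), fun x hx hinit n => ?_⟩
  set δ := min ε ((A - b) / S)
  have hSδ : S * δ ≤ A - b := by
    have := min_le_right ε ((A - b) / S)
    rw [mul_comm]
    exact (le_div_iff₀ hBsum).1 this
  suffices h : |x n - e| < δ from h.trans_le (min_le_left _ _)
  induction n using Nat.strong_induction_on with
  | _ n ih =>
    by_cases hn : n < k
    · exact hinit n hn
    obtain ⟨m, rfl⟩ : ∃ m, n = m + k := ⟨n - k, by omega⟩
    have hpast : ∀ i ∈ Finset.Icc 1 k, |x (m + k - i) - e| < δ := fun i hi => by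
      rw [Finset.mem_Icc] at hi
      exact ih _ (by omega)
    -- A common bound `ρ < δ` for the finitely many past deviations keeps the inequality strict.
    obtain ⟨j₀, hj₀⟩ := posIndices_nonempty hBsum
    have hj₀ := (mem_posIndices.1 hj₀).1
    obtain ⟨i₀, hi₀, hmax⟩ := Finset.exists_max_image (Finset.Icc 1 k)
      (fun i => |x (m + k - i) - e|) ⟨j₀, hj₀⟩
    set ρ := |x (m + k - i₀) - e|
    have hρ : ρ < δ := hpast i₀ hi₀
    have hρ0 : 0 ≤ ρ := abs_nonneg _
    have hx1 := hx.mul_denom m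
    have hβ1 := sum_mul_le_of_pos (M := e + ρ) hβ
      (fun i hi _ => by linarith [(abs_le.1 (hmax i hi)).2] : ∀ i ∈ _, _ → x (m + k - i) ≤ e + ρ)
    have hβ2 := le_sum_mul_of_pos (m := e - ρ) hβ
      (fun i hi _ => by linarith [(abs_le.1 (hmax i hi)).1] : ∀ i ∈ _, _ → e - ρ ≤ x (m + k - i))
    have hB1 := sum_mul_le_of_pos (M := e + ρ) hB
      (fun i hi _ => by linarith [(abs_le.1 (hmax i hi)).2] : ∀ i ∈ _, _ → x (m + k - i) ≤ e + ρ)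
    have hB2 := le_sum_mul_of_pos (m := e - ρ) hB
      (fun i hi _ => by linarith [(abs_le.1 (hmax i hi)).1] : ∀ i ∈ _, _ → e - ρ ≤ x (m + k - i))
    set D := ∑ j ∈ Finset.Icc 1 k, B j * x (m + k - j)
    set N := ∑ i ∈ Finset.Icc 1 k, β i * x (m + k - i)
    have hb0 : 0 ≤ b := Finset.sum_nonneg hβ
    have hden : b + S * e ≤ A + D := by nlinarith
    have hdenpos : 0 < A + D := by
      have : 0 < S * e := mul_pos hBsum he
      linarith
    have hdev : (x (m + k) - e) * (A + D) = (N - b * e) - e * (D - S * e) := by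
      linear_combination hx1 - heq
    have hDe : e * (D - S * e) ≤ e * (S * ρ) ∧ -(e * (S * ρ)) ≤ e * (D - S * e) :=
      ⟨mul_le_mul_of_nonneg_left (by linarith) he.le, by
        rw [← mul_neg]; exact mul_le_mul_of_nonneg_left (by linarith) he.le⟩
    have hnum : |x (m + k) - e| * (A + D) ≤ ρ * (b + S * e) := by
      rw [show |x (m + k) - e| * (A + D) = |(x (m + k) - e) * (A + D)| by
        rw [abs_mul, abs_of_pos hdenpos], hdev, abs_le]
      constructor <;> nlinarith [hDe.1, hDe.2]
    have : |x (m + k) - e| * (A + D) ≤ ρ * (A + D) :=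
      hnum.trans (mul_le_mul_of_nonneg_left hden hρ0)
    exact (le_of_mul_le_mul_right this hdenpos).trans_lt hρ

theorem IsSolution.exists_upper_bound {x : ℕ → ℝ} (hx : IsSolution k α A β B x) (hα : 0 < α)
    (hA : 0 ≤ A) (hβ : ∀ i ∈ Finset.Icc 1 k, 0 ≤ β i) (hB : ∀ j ∈ Finset.Icc 1 k, 0 ≤ B j)
    (hlt : ∑ i ∈ Finset.Icc 1 k, β i < A) : ∃ C, ∀ n, x n ≤ C := by
  obtain ⟨C, hC⟩ := ((Finset.range k).image x).exists_le
  set b := ∑ i ∈ Finset.Icc 1 k, β i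
  have hAb : 0 < A - b := sub_pos.2 hlt
  have hCα : α ≤ (A - b) * max C (α / (A - b)) := by
    rw [mul_comm]
    exact (div_le_iff₀ hAb).1 (le_max_right _ _)
  refine ⟨max C (α / (A - b)), fun n => ?_⟩
  induction n using Nat.strong_induction_on with
  | _ n ih =>
    by_cases hn : n < k
    · exact (hC _ (Finset.mem_image_of_mem _ (Finset.mem_range.2 hn))).trans (le_max_left _ _)
    obtain ⟨m, rfl⟩ : ∃ m, n = m + k := ⟨n - k, by omega⟩
    have hβ1 := sum_mul_le_of_pos (M := max C (α / (A - b))) (f := fun i => x (m + k - i)) hβ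
      fun i hi _ => by
        rw [Finset.mem_Icc] at hi
        exact ih _ (by omega)
    have h0 : 0 ≤ ∑ j ∈ Finset.Icc 1 k, B j * x (m + k - j) :=
      Finset.sum_nonneg fun i hi => mul_nonneg (hB i hi) (hx.nonneg hα hA hβ hB _)
    have hx0 := hx.nonneg hα hA hβ hB (m + k)
    have hx1 := hx.mul_denom m
    have hApos : 0 < A := (Finset.sum_nonneg hβ).trans_lt hlt
    refine le_of_mul_le_mul_right (a := A) ?_ hApos
    have := mul_nonneg hx0 h0
    change _ ≤ b * _ at hβ1
    nlinarith

/-- With `S` and `I` the limits superior and inferior of a solution, the recurrence gives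
`S (A + I ∑ B) ≤ α + S ∑ β` and `α + I ∑ β ≤ I (A + S ∑ B)`, whence `S ≤ I`. -/
theorem isGlobalAttractor_of_lt (hα : 0 < α) (hA : 0 ≤ A)
    (hβ : ∀ i ∈ Finset.Icc 1 k, 0 ≤ β i) (hB : ∀ j ∈ Finset.Icc 1 k, 0 ≤ B j)
    (hBsum : 0 < ∑ j ∈ Finset.Icc 1 k, B j) (hlt : ∑ i ∈ Finset.Icc 1 k, β i < A) {e : ℝ}
    (he : 0 < e) (heq : e * (A + (∑ j ∈ Finset.Icc 1 k, B j) * e) =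
      α + (∑ i ∈ Finset.Icc 1 k, β i) * e) :
    IsGlobalAttractor k α A β B e := by
  intro x hx
  obtain ⟨C, hC⟩ := hx.exists_upper_bound hα hA hβ hB hlt
  have hnn := hx.nonneg hα hA hβ hB
  have hbdd : IsBoundedUnder (· ≤ ·) atTop x := isBoundedUnder_of ⟨C, hC⟩
  have hbdd' : IsBoundedUnder (· ≥ ·) atTop x := isBoundedUnder_of ⟨0, hnn⟩
  have hApos : 0 < A := (Finset.sum_nonneg hβ).trans_lt hlt
  set b := ∑ i ∈ Finset.Icc 1 k, β i
  set s := ∑ j ∈ Finset.Icc 1 k, B j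
  set S := limsup x atTop
  set I := liminf x atTop
  have hI0 : 0 ≤ I := le_liminf_of_le hbdd.isCoboundedUnder_ge (Eventually.of_forall hnn)
  have hIS : I ≤ S := liminf_le_limsup hbdd hbdd'
  have hb0 : 0 ≤ b := Finset.sum_nonneg hβ
  have htail : ∀ δ > 0, ∃ T, ∀ n, T ≤ n → I - δ ≤ x n ∧ x n ≤ S + δ := fun δ hδ => by
    have h1 := eventually_lt_of_limsup_lt (show limsup x atTop < S + δ by linarith) hbdd
    have h2 := eventually_lt_of_lt_liminf (show I - δ < liminf x atTop by linarith) hbdd'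
    obtain ⟨T, hT⟩ := eventually_atTop.1 (h1.and h2)
    exact ⟨T, fun n hn => ⟨(hT n hn).2.le, (hT n hn).1.le⟩⟩
  have hsmall : ∀ᶠ δ in 𝓝[>] (0 : ℝ), 0 < A + s * (I - δ) := by
    have : Tendsto (fun δ : ℝ => A + s * (I - δ)) (𝓝[>] 0) (𝓝 (A + s * (I - 0))) :=
      ((by fun_prop : Continuous fun δ : ℝ => A + s * (I - δ)).tendsto 0).mono_left
        nhdsWithin_le_nhds
    refine this.eventually (lt_mem_nhds ?_)
    have := mul_nonneg hBsum.le hI0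
    linarith
  have hSle : S * (A + s * I) ≤ α + b * S := by
    have hδ : ∀ᶠ δ in 𝓝[>] (0 : ℝ), (S - δ) * (A + s * (I - δ)) ≤ α + b * (S + δ) := by
      filter_upwards [hsmall, self_mem_nhdsWithin] with δ hδ hδ0
      have hδ0 : 0 < δ := hδ0
      obtain ⟨T, hT⟩ := htail δ hδ0
      obtain ⟨n, hnT, hn⟩ := frequently_atTop.1 (frequently_lt_of_lt_limsup
        hbdd'.isCoboundedUnder_le (show S - δ < limsup x atTop by linarith)) (T + k)
      obtain ⟨m, rfl⟩ : ∃ m, n = m + k := ⟨n - k, by omega⟩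
      have h1 := sum_mul_le_of_pos (M := S + δ) hβ (fun i hi _ => (hT _ (by
        rw [Finset.mem_Icc] at hi; omega)).2 : ∀ i ∈ _, _ → x (m + k - i) ≤ S + δ)
      have h2 := le_sum_mul_of_pos (m := I - δ) hB (fun i hi _ => (hT _ (by
        rw [Finset.mem_Icc] at hi; omega)).1 : ∀ i ∈ _, _ → I - δ ≤ x (m + k - i))
      calc (S - δ) * (A + s * (I - δ)) ≤ x (m + k) * (A + s * (I - δ)) :=
            mul_le_mul_of_nonneg_right hn.le hδ.le
        _ ≤ x (m + k) * (A + ∑ j ∈ Finset.Icc 1 k, B j * x (m + k - j)) :=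
            mul_le_mul_of_nonneg_left (by linarith) (hnn _)
        _ = _ := hx.mul_denom m
        _ ≤ _ := by linarith
    have hl : Tendsto (fun δ : ℝ => (S - δ) * (A + s * (I - δ))) (𝓝[>] 0)
        (𝓝 ((S - 0) * (A + s * (I - 0)))) :=
      ((by fun_prop : Continuous fun δ : ℝ => (S - δ) * (A + s * (I - δ))).tendsto 0).mono_left
        nhdsWithin_le_nhds
    have hr : Tendsto (fun δ : ℝ => α + b * (S + δ)) (𝓝[>] 0) (𝓝 (α + b * (S + 0))) :=
      ((by fun_prop : Continuous fun δ : ℝ => α + b * (S + δ)).tendsto 0).mono_left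
        nhdsWithin_le_nhds
    simpa using le_of_tendsto_of_tendsto hl hr hδ
  have hIge : α + b * I ≤ I * (A + s * S) := by
    have hδ : ∀ᶠ δ in 𝓝[>] (0 : ℝ), α + b * (I - δ) ≤ (I + δ) * (A + s * (S + δ)) := by
      filter_upwards [self_mem_nhdsWithin] with δ hδ0
      have hδ0 : 0 < δ := hδ0
      obtain ⟨T, hT⟩ := htail δ hδ0
      obtain ⟨n, hnT, hn⟩ := frequently_atTop.1 (frequently_lt_of_liminf_lt
        hbdd.isCoboundedUnder_ge (show liminf x atTop < I + δ by linarith)) (T + k)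
      obtain ⟨m, rfl⟩ : ∃ m, n = m + k := ⟨n - k, by omega⟩
      have h1 := le_sum_mul_of_pos (m := I - δ) hβ (fun i hi _ => (hT _ (by
        rw [Finset.mem_Icc] at hi; omega)).1 : ∀ i ∈ _, _ → I - δ ≤ x (m + k - i))
      have h2 := sum_mul_le_of_pos (M := S + δ) hB (fun i hi _ => (hT _ (by
        rw [Finset.mem_Icc] at hi; omega)).2 : ∀ i ∈ _, _ → x (m + k - i) ≤ S + δ)
      calc α + b * (I - δ) ≤ α + ∑ i ∈ Finset.Icc 1 k, β i * x (m + k - i) := by linarith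
        _ = _ := (hx.mul_denom m).symm
        _ ≤ x (m + k) * (A + s * (S + δ)) :=
            mul_le_mul_of_nonneg_left (by linarith) (hnn _)
        _ ≤ _ := mul_le_mul_of_nonneg_right hn.le
            (add_nonneg hA (mul_nonneg hBsum.le (by linarith)))
    have hl : Tendsto (fun δ : ℝ => α + b * (I - δ)) (𝓝[>] 0) (𝓝 (α + b * (I - 0))) :=
      ((by fun_prop : Continuous fun δ : ℝ => α + b * (I - δ)).tendsto 0).mono_left
        nhdsWithin_le_nhds
    have hr : Tendsto (fun δ : ℝ => (I + δ) * (A + s * (S + δ))) (𝓝[>] 0)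
        (𝓝 ((I + 0) * (A + s * (S + 0)))) :=
      ((by fun_prop : Continuous fun δ : ℝ => (I + δ) * (A + s * (S + δ))).tendsto 0).mono_left
        nhdsWithin_le_nhds
    simpa using le_of_tendsto_of_tendsto hl hr hδ
  have hSI : S = I := by
    refine le_antisymm ?_ hIS
    refine le_of_mul_le_mul_left (a := A - b) ?_ (sub_pos.2 hlt)
    linarith
  have hroot : I * (A + s * I) = α + b * I := by
    rw [hSI] at hSle hIge
    exact le_antisymm hSle hIge
  have hIe : I = e := quadratic_root_unique hBsum hlt he.le hI0 heq hroot
  exact tendsto_of_le_liminf_of_limsup_le hIe.ge (hSI.trans hIe).le hbdd hbdd'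

end Stable


/-! ### The two phases modulo `2g` -/

section Phases

variable {g n : ℕ}

theorem even_sub_div_iff (hg : 0 < g) {i : ℕ} (hi : 2 * g ∣ i) (hin : i ≤ n) :
    Even ((n - i) / g) ↔ Even (n / g) := by
  obtain ⟨s, rfl⟩ := hi
  obtain ⟨a, rfl⟩ := Nat.exists_eq_add_of_le' hin
  rw [Nat.add_sub_cancel, show 2 * g * s = g * (2 * s) by ring, Nat.add_mul_div_left _ _ hg]
  simp [Nat.even_add]

theorem even_sub_div_iff_not (hg : 0 < g) {j : ℕ} (hj : 2 * g ∣ j + g) (hjn : j ≤ n) :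
    Even ((n - j) / g) ↔ ¬ Even (n / g) := by
  obtain ⟨s, hs⟩ := hj
  obtain ⟨a, rfl⟩ := Nat.exists_eq_add_of_le' hjn
  obtain rfl | ⟨t, rfl⟩ : s = 0 ∨ ∃ t, s = t + 1 := by
    cases s with
    | zero => exact Or.inl rfl
    | succ t => exact Or.inr ⟨t, rfl⟩
  · omega
  have hj : j = g * (2 * t + 1) := by
    apply Nat.add_right_cancel (m := g)
    rw [hs]; ring
  rw [Nat.add_sub_cancel, hj, Nat.add_mul_div_left _ _ hg]
  simp [Nat.even_add, parity_simps]

theorem sub_mod_of_dvd {i : ℕ} (hi : g ∣ i) (hin : i ≤ n) : (n - i) % g = n % g := by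
  obtain ⟨s, rfl⟩ := hi
  obtain ⟨a, rfl⟩ := Nat.exists_eq_add_of_le' hin
  rw [Nat.add_sub_cancel, Nat.add_mul_mod_self_left]

theorem dvd_of_two_mul_dvd_add {j : ℕ} (hj : 2 * g ∣ j + g) : g ∣ j :=
  (Nat.dvd_add_left (dvd_refl g)).1 ((dvd_mul_left g 2).trans hj)

/-- The sequence of period `2g` that equals `f r` at `r` and `c / f r` at `r + g`,
for `0 ≤ r < g`. -/
noncomputable def alternating (g : ℕ) (c : ℝ) (f : ℕ → ℝ) (n : ℕ) : ℝ :=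
  if Even (n / g) then f (n % g) else c / f (n % g)

theorem alternating_pos {c : ℝ} {f : ℕ → ℝ} (hc : 0 < c) (hf : ∀ r, 0 < f r) (n : ℕ) :
    0 < alternating g c f n := by
  unfold alternating
  split_ifs
  exacts [hf _, div_pos hc (hf _)]

theorem alternating_sub_of_dvd {c : ℝ} {f : ℕ → ℝ} (hg : 0 < g) {i : ℕ} (hi : 2 * g ∣ i)
    (hin : i ≤ n) : alternating g c f (n - i) = alternating g c f n := by
  unfold alternating
  simp only [even_sub_div_iff hg hi hin, sub_mod_of_dvd ((dvd_mul_left g 2).trans hi) hin]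

theorem alternating_sub_of_dvd_add {c : ℝ} {f : ℕ → ℝ} (hg : 0 < g) (hc : 0 < c)
    {j : ℕ} (hj : 2 * g ∣ j + g) (hjn : j ≤ n) :
    alternating g c f (n - j) = c / alternating g c f n := by
  unfold alternating
  simp only [even_sub_div_iff_not hg hj hjn, sub_mod_of_dvd (dvd_of_two_mul_dvd_add hj) hjn]
  by_cases h : Even (n / g)
  · simp [h]
  · simp [h, div_div_cancel₀ hc.ne']

theorem hasPeriod_alternating (hg : 0 < g) (c : ℝ) (f : ℕ → ℝ) :
    HasPeriod (alternating g c f) (2 * g) := by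
  refine ⟨by omega, fun n => ?_⟩
  have := alternating_sub_of_dvd (c := c) (f := f) hg (dvd_refl (2 * g))
    (Nat.le_add_left (2 * g) n)
  rw [← this, Nat.add_sub_cancel]

theorem tendsto_of_residues {f : ℕ → ℝ} {a : ℝ} (hg : 0 < g)
    (h : ∀ r, r < g → Tendsto (fun t => f (r + g * t)) atTop (𝓝 a)) :
    Tendsto f atTop (𝓝 a) := by
  rw [tendsto_def]
  intro s hs
  have h1 : ∀ᶠ t in atTop, ∀ r ∈ Finset.range g, f (r + g * t) ∈ s :=
    (Filter.eventually_all_finset _).2 fun r hr => h r (Finset.mem_range.1 hr) hs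
  have h2 := (Nat.tendsto_div_const_atTop hg.ne').eventually h1
  filter_upwards [h2] with n hn
  have := hn (n % g) (Finset.mem_range.2 (Nat.mod_lt _ hg))
  rwa [Nat.mod_add_div] at this

end Phases

section Gcd

variable {k : ℕ} {β B : ℕ → ℝ}

theorem delayGcd_dvd {i : ℕ} (hi : i ∈ posIndices k β ∪ posIndices k B) :
    delayGcd k β B ∣ i := Finset.gcd_dvd (f := id) hi

theorem delayGcd_pos (hBsum : 0 < ∑ j ∈ Finset.Icc 1 k, B j) : 0 < delayGcd k β B := by
  obtain ⟨j, hj⟩ := posIndices_nonempty hBsum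
  refine Nat.pos_of_dvd_of_pos (delayGcd_dvd (Finset.mem_union_right _ hj)) ?_
  exact (Finset.mem_Icc.1 (mem_posIndices.1 hj).1).1

end Gcd

section Main

variable {k : ℕ} {α A : ℝ} {β B : ℕ → ℝ} {g : ℕ}

/-! ### Unbounded solutions -/

/-- Starting from large values in one phase and small ones in the other, the small phase stays
small and the large phase grows geometrically. -/
theorem exists_unbounded_solution (hα : 0 < α) (hA : 0 ≤ A)
    (hβ : ∀ i ∈ Finset.Icc 1 k, 0 ≤ β i) (hB : ∀ j ∈ Finset.Icc 1 k, 0 ≤ B j)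
    (hBsum : 0 < ∑ j ∈ Finset.Icc 1 k, B j) (hg : 0 < g)
    (hdvdβ : ∀ i ∈ posIndices k β, 2 * g ∣ i) (hdvdB : ∀ j ∈ posIndices k B, 2 * g ∣ j + g)
    (hlt : A < ∑ i ∈ Finset.Icc 1 k, β i) :
    ∃ x : ℕ → ℝ, IsSolution k α A β B x ∧ ¬ Bornology.IsBounded (Set.range x) := by
  set b := ∑ i ∈ Finset.Icc 1 k, β i with hb
  set S := ∑ j ∈ Finset.Icc 1 k, B j with hS
  -- `m` makes the growth factor `b / (A + S m)` exceed `1`; `M` solves `m (A + S M) = α + b m`.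
  obtain ⟨m, hm, hmS⟩ : ∃ m, 0 < m ∧ S * m = (b - A) / 2 :=
    ⟨(b - A) / 2 / S, div_pos (by linarith) hBsum, by field_simp⟩
  obtain ⟨M, hM, hmM⟩ : ∃ M, 0 < M ∧ m * (A + S * M) = α + b * m := by
    refine ⟨(b - A) / S + α / (S * m), ?_, by field_simp; ring⟩
    have := sub_pos.2 hlt
    positivity
  set init : ℕ → ℝ := fun n => if Even (n / g) then M else m with hinit
  set x := solutionOf k α A β B init
  obtain ⟨hpos, hx⟩ : (∀ n, 0 < x n) ∧ IsSolution k α A β B x :=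
    isSolution_solutionOf hα hA hβ hB hBsum fun n _ => by
      simp only [hinit]
      split_ifs <;> assumption
  have hbpos : 0 < b := hA.trans_lt hlt
  have hpastβ : ∀ n i, i ∈ Finset.Icc 1 k → 0 < β i →
      (Even ((n + k - i) / g) ↔ Even ((n + k) / g)) := fun n i hi h =>
    even_sub_div_iff hg (hdvdβ i (mem_posIndices.2 ⟨hi, h⟩)) (by
      rw [Finset.mem_Icc] at hi; omega)
  have hpastB : ∀ n j, j ∈ Finset.Icc 1 k → 0 < B j →
      (Even ((n + k - j) / g) ↔ ¬ Even ((n + k) / g)) := fun n j hj h =>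
    even_sub_div_iff_not hg (hdvdB j (mem_posIndices.2 ⟨hj, h⟩)) (by
      rw [Finset.mem_Icc] at hj; omega)
  have hphase : ∀ n, (Even (n / g) → M ≤ x n) ∧ (¬ Even (n / g) → x n ≤ m) := fun n => by
    induction n using Nat.strong_induction_on with
    | _ n ih =>
      by_cases hn : n < k
      · rw [show x n = init n from solutionOf_of_lt hn]
        exact ⟨fun h => by simp [hinit, h], fun h => by simp [hinit, h]⟩
      obtain ⟨l, rfl⟩ : ∃ l, n = l + k := ⟨n - k, by omega⟩
      have hlt' : ∀ i ∈ Finset.Icc 1 k, l + k - i < l + k := fun i hi => by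
        rw [Finset.mem_Icc] at hi; omega
      have heq := hx.mul_denom l
      refine ⟨fun h => ?_, fun h => ?_⟩
      · have h1 := le_sum_mul_of_pos (m := M) (f := fun i => x (l + k - i)) hβ fun i hi hβi =>
          (ih _ (hlt' i hi)).1 ((hpastβ l i hi hβi).2 h)
        have h2 := sum_mul_le_of_pos (M := m) (f := fun i => x (l + k - i)) hB fun i hi hBi =>
          (ih _ (hlt' i hi)).2 (fun h' => (hpastB l i hi hBi).1 h' h)
        have h3 : 0 < A + S * m := by linarith
        refine le_of_mul_le_mul_right (a := A + S * m) ?_ h3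
        calc M * (A + S * m) ≤ α + b * M := by rw [hmS]; nlinarith
          _ ≤ α + ∑ i ∈ Finset.Icc 1 k, β i * x (l + k - i) := by linarith
          _ = _ := heq.symm
          _ ≤ x (l + k) * (A + S * m) :=
            mul_le_mul_of_nonneg_left (by linarith) (hpos _).le
      · have h1 := sum_mul_le_of_pos (M := m) (f := fun i => x (l + k - i)) hβ fun i hi hβi =>
          (ih _ (hlt' i hi)).2 (fun h' => h ((hpastβ l i hi hβi).1 h'))
        have h2 := le_sum_mul_of_pos (m := M) (f := fun i => x (l + k - i)) hB fun i hi hBi =>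
          (ih _ (hlt' i hi)).1 ((hpastB l i hi hBi).2 h)
        have h3 : 0 < A + S * M := add_pos_of_nonneg_of_pos hA (mul_pos hBsum hM)
        refine le_of_mul_le_mul_right (a := A + S * M) ?_ h3
        calc x (l + k) * (A + S * M)
            ≤ x (l + k) * (A + ∑ j ∈ Finset.Icc 1 k, B j * x (l + k - j)) :=
              mul_le_mul_of_nonneg_left (by linarith) (hpos _).le
          _ = _ := heq
          _ ≤ α + b * m := by linarith
          _ = _ := hmM.symm
  have hden : 0 < A + S * m := by linarith
  set q := b / (A + S * m) with hq
  have hq1 : 1 < q := by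
    rw [hq, one_lt_div hden]
    linarith
  have hqmul : q * (A + S * m) = b := div_mul_cancel₀ _ hden.ne'
  have hgrow : ∀ p n, p * k ≤ n → Even (n / g) → q ^ p * M ≤ x n := fun p => by
    induction p with
    | zero => exact fun n _ h => by simpa using (hphase n).1 h
    | succ p ih =>
      intro n hn h
      rw [Nat.succ_mul] at hn
      obtain ⟨l, rfl⟩ : ∃ l, n = l + k := ⟨n - k, by omega⟩
      have h1 := le_sum_mul_of_pos (m := q ^ p * M) (f := fun i => x (l + k - i)) hβ
        fun i hi hβi => ih _ (by rw [Finset.mem_Icc] at hi; omega) ((hpastβ l i hi hβi).2 h)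
      have h2 := sum_mul_le_of_pos (M := m) (f := fun i => x (l + k - i)) hB fun i hi hBi =>
        (hphase _).2 (fun h' => (hpastB l i hi hBi).1 h' h)
      refine le_of_mul_le_mul_right (a := A + S * m) ?_ hden
      calc q ^ (p + 1) * M * (A + S * m) = q ^ p * M * (q * (A + S * m)) := by ring
        _ = b * (q ^ p * M) := by rw [hqmul]; ring
        _ ≤ α + ∑ i ∈ Finset.Icc 1 k, β i * x (l + k - i) := by linarith
        _ = _ := (hx.mul_denom l).symm
        _ ≤ x (l + k) * (A + S * m) :=
          mul_le_mul_of_nonneg_left (by linarith) (hpos _).le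
  refine ⟨x, hx, fun hbd => ?_⟩
  obtain ⟨C, hC⟩ := hbd.exists_norm_le
  obtain ⟨p, hp⟩ := pow_unbounded_of_one_lt (C / M) hq1
  have h1 := hgrow p (g * (2 * (p * k))) ((Nat.le_mul_of_pos_left _ two_pos).trans
    (Nat.le_mul_of_pos_left _ hg)) (by rw [Nat.mul_div_cancel_left _ hg]; exact even_two_mul _)
  have h2 := (le_abs_self _).trans (hC _ (Set.mem_range_self (g * (2 * (p * k)))))
  rw [div_lt_iff₀ hM] at hp
  linarith

/-! ### Solutions of period `2g` in the critical case -/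

theorem isSolution_alternating {c : ℝ} {f : ℕ → ℝ} (hα : 0 < α)
    (hβ : ∀ i ∈ Finset.Icc 1 k, 0 ≤ β i) (hB : ∀ j ∈ Finset.Icc 1 k, 0 ≤ B j)
    (hBsum : 0 < ∑ j ∈ Finset.Icc 1 k, B j) (hg : 0 < g)
    (hdvdβ : ∀ i ∈ posIndices k β, 2 * g ∣ i) (hdvdB : ∀ j ∈ posIndices k B, 2 * g ∣ j + g)
    (hc : (∑ j ∈ Finset.Icc 1 k, B j) * c = α) (hf : ∀ r, 0 < f r) :
    IsSolution k α (∑ i ∈ Finset.Icc 1 k, β i) β B (alternating g c f) := by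
  have hcpos : 0 < c := pos_of_mul_pos_right (hc ▸ hα) hBsum.le
  have hy := alternating_pos (g := g) hcpos hf
  have h1 : ∀ n, ∑ i ∈ Finset.Icc 1 k, β i * alternating g c f (n + k - i) =
      (∑ i ∈ Finset.Icc 1 k, β i) * alternating g c f (n + k) := fun n => by
    rw [Finset.sum_mul]
    refine Finset.sum_congr rfl fun i hi => ?_
    rcases (hβ i hi).eq_or_lt with h | h
    · simp [← h]
    · rw [alternating_sub_of_dvd hg (hdvdβ i (mem_posIndices.2 ⟨hi, h⟩))
        (by rw [Finset.mem_Icc] at hi; omega)]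
  have h2 : ∀ n, ∑ j ∈ Finset.Icc 1 k, B j * alternating g c f (n + k - j) =
      (∑ j ∈ Finset.Icc 1 k, B j) * (c / alternating g c f (n + k)) := fun n => by
    rw [Finset.sum_mul]
    refine Finset.sum_congr rfl fun j hj => ?_
    rcases (hB j hj).eq_or_lt with h | h
    · simp [← h]
    · rw [alternating_sub_of_dvd_add hg hcpos (hdvdB j (mem_posIndices.2 ⟨hj, h⟩))
        (by rw [Finset.mem_Icc] at hj; omega)]
  have hden : ∀ n, 0 < ∑ i ∈ Finset.Icc 1 k, β i +
      (∑ j ∈ Finset.Icc 1 k, B j) * (c / alternating g c f (n + k)) := fun n =>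
    add_pos_of_nonneg_of_pos (Finset.sum_nonneg hβ) (mul_pos hBsum (div_pos hcpos (hy _)))
  refine ⟨fun n _ => (hy n).le, fun n => ?_, fun n => ?_⟩
  · rw [h2]
    exact (hden n).ne'
  · rw [h1, h2, eq_div_iff (hden n).ne', ← hc]
    have := (hy (n + k)).ne'
    field_simp
    ring

/-- The base value at residue `0` differs from the square root of `c` and from all other values,
so that a period is a multiple of `2g`. -/
theorem exists_hasPrimePeriod_alternating {c : ℝ} (hc : 0 < c) (hg : 0 < g) :
    ∃ f : ℕ → ℝ, (∀ r, 0 < f r) ∧ HasPrimePeriod (alternating g c f) (2 * g) := by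
  have hs : 0 < √c := Real.sqrt_pos.2 hc
  have hcs : √c * √c = c := Real.mul_self_sqrt hc.le
  refine ⟨fun r => if r = 0 then 2 * √c else √c, fun r => ?_, hasPeriod_alternating hg _ _,
    fun q hq => ?_⟩
  · dsimp only
    split_ifs <;> positivity
  have h0 := hq.2 0
  have hz : alternating g c (fun r => if r = 0 then 2 * √c else √c) 0 = 2 * √c := by
    simp [alternating]
  rw [zero_add, hz] at h0
  have hlt1 : c / (2 * √c) < 2 * √c := by
    rw [div_lt_iff₀ (by positivity)]
    nlinarith
  have hlt2 : c / √c < 2 * √c := by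
    rw [div_lt_iff₀ hs]
    nlinarith
  unfold alternating at h0
  have hmod : q % g = 0 := by
    by_contra h
    simp only [h, if_false] at h0
    split_ifs at h0 <;> linarith
  have hev : Even (q / g) := by
    by_contra h
    simp only [h, hmod, if_false, if_true] at h0
    linarith
  obtain ⟨t, ht⟩ := hev
  have hqg : q = g * (t + t) := by
    rw [← ht]
    exact (Nat.mul_div_cancel' (Nat.dvd_of_mod_eq_zero hmod)).symm
  have ht0 : 0 < t := by
    rcases Nat.eq_zero_or_pos t with rfl | h
    · have := hq.1
      simp [hqg] at this
    · exact h
  rw [hqg, show g * (t + t) = 2 * g * t by ring]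
  exact Nat.le_mul_of_pos_right _ ht0

/-! ### Convergence in the critical case -/

/-- In the critical case the solution stays in an interval `[m, M]` with `m M = α / ∑ B`, since
such an interval is invariant. -/
theorem IsSolution.exists_bounds {x : ℕ → ℝ} {c : ℝ} (hα : 0 < α)
    (hβ : ∀ i ∈ Finset.Icc 1 k, 0 ≤ β i) (hB : ∀ j ∈ Finset.Icc 1 k, 0 ≤ B j)
    (hBsum : 0 < ∑ j ∈ Finset.Icc 1 k, B j) (hc : (∑ j ∈ Finset.Icc 1 k, B j) * c = α)
    (hx : IsSolution k α (∑ i ∈ Finset.Icc 1 k, β i) β B x) :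
    ∃ m M, 0 < m ∧ 0 < M ∧ m * M = c ∧ ∀ n, k ≤ n → m ≤ x n ∧ x n ≤ M := by
  have hcpos : 0 < c := pos_of_mul_pos_right (hc ▸ hα) hBsum.le
  have hb0 : 0 ≤ ∑ i ∈ Finset.Icc 1 k, β i := Finset.sum_nonneg hβ
  have hxpos : ∀ n, k ≤ n → 0 < x n := fun n hn => by
    obtain ⟨l, rfl⟩ := Nat.exists_eq_add_of_le' hn
    exact hx.pos hα hb0 hβ hB l
  obtain ⟨C₁, hC₁⟩ := ((Finset.Ico k (2 * k)).image x).exists_le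
  obtain ⟨C₂, hC₂⟩ := ((Finset.Ico k (2 * k)).image fun n => c / x n).exists_le
  set M := max 1 (max C₁ C₂)
  have hM : 0 < M := one_pos.trans_le (le_max_left _ _)
  have hcM : c / M * M = c := div_mul_cancel₀ _ hM.ne'
  have hm : 0 < c / M := div_pos hcpos hM
  set m := c / M
  set b := ∑ i ∈ Finset.Icc 1 k, β i with hb
  set S := ∑ j ∈ Finset.Icc 1 k, B j
  refine ⟨m, M, hm, hM, hcM, fun n => ?_⟩
  induction n using Nat.strong_induction_on with
  | _ n ih =>
    intro hn
    by_cases hlt : n < 2 * k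
    · have hmem : n ∈ Finset.Ico k (2 * k) := Finset.mem_Ico.2 ⟨hn, hlt⟩
      have h1 : x n ≤ M := (hC₁ _ (Finset.mem_image_of_mem _ hmem)).trans
        ((le_max_left _ _).trans (le_max_right _ _))
      have h2 : c / x n ≤ M := (hC₂ _ (Finset.mem_image_of_mem _ hmem)).trans
        ((le_max_right _ _).trans (le_max_right _ _))
      refine ⟨?_, h1⟩
      rw [div_le_iff₀ (hxpos n hn)] at h2
      exact (div_le_iff₀ hM).2 (by linarith)
    obtain ⟨l, rfl⟩ := Nat.exists_eq_add_of_le' hn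
    have hpast : ∀ i ∈ Finset.Icc 1 k, m ≤ x (l + k - i) ∧ x (l + k - i) ≤ M := fun i hi => by
      rw [Finset.mem_Icc] at hi
      exact ih _ (by omega) (by omega)
    have heq := hx.mul_denom l
    have hβ1 := le_sum_mul_of_pos (f := fun i => x (l + k - i)) hβ fun i hi _ => (hpast i hi).1
    have hβ2 := sum_mul_le_of_pos (f := fun i => x (l + k - i)) hβ fun i hi _ => (hpast i hi).2
    have hB1 := le_sum_mul_of_pos (f := fun i => x (l + k - i)) hB fun i hi _ => (hpast i hi).1
    have hB2 := sum_mul_le_of_pos (f := fun i => x (l + k - i)) hB fun i hi _ => (hpast i hi).2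
    have hx0 := (hxpos _ hn).le
    constructor
    · refine le_of_mul_le_mul_right (a := b + S * M) ?_
        (add_pos_of_nonneg_of_pos hb0 (mul_pos hBsum hM))
      calc m * (b + S * M) = α + b * m := by rw [← hc, ← hcM]; ring
        _ ≤ α + ∑ i ∈ Finset.Icc 1 k, β i * x (l + k - i) := by linarith
        _ = _ := heq.symm
        _ ≤ _ := mul_le_mul_of_nonneg_left (by linarith) hx0
    · refine le_of_mul_le_mul_right (a := b + S * m) ?_
        (add_pos_of_nonneg_of_pos hb0 (mul_pos hBsum hm))
      calc x (l + k) * (b + S * m)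
          ≤ x (l + k) * (b + ∑ j ∈ Finset.Icc 1 k, B j * x (l + k - j)) :=
            mul_le_mul_of_nonneg_left (by linarith) hx0
        _ = _ := heq
        _ ≤ α + b * M := by linarith
        _ = M * (b + S * m) := by rw [← hc, ← hcM]; ring

/-- In the critical case, replacing `x n` by `c / x n`, `c = α / ∑ B`, in one of the two phases
turns the recurrence into a weighted mean over the delays in `I_β ∪ I_B`. -/
theorem IsSolution.averages {x : ℕ → ℝ} {c m M : ℝ}
    (hβ : ∀ i ∈ Finset.Icc 1 k, 0 ≤ β i) (hB : ∀ j ∈ Finset.Icc 1 k, 0 ≤ B j)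
    (hBsum : 0 < ∑ j ∈ Finset.Icc 1 k, B j) (hg : 0 < g)
    (hdvdβ : ∀ i ∈ posIndices k β, 2 * g ∣ i) (hdvdB : ∀ j ∈ posIndices k B, 2 * g ∣ j + g)
    (hc : (∑ j ∈ Finset.Icc 1 k, B j) * c = α) (hcpos : 0 < c)
    (hx : IsSolution k α (∑ i ∈ Finset.Icc 1 k, β i) β B x)
    (hm : 0 < m) (hbd : ∀ n, k ≤ n → m ≤ x n ∧ x n ≤ M) :
    ∃ ε > 0, Averages (fun n => if Even (n / g) then x n else c / x n)
      (↑(posIndices k β ∪ posIndices k B)) ε (2 * k) := by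
  have hM : 0 < M := hm.trans_le ((hbd k le_rfl).1.trans (hbd k le_rfl).2)
  have hxpos : ∀ n, k ≤ n → 0 < x n := fun n hn => hm.trans_le (hbd n hn).1
  obtain ⟨j₀, hj₀⟩ := posIndices_nonempty hBsum
  have hJk : ∀ j ∈ posIndices k β ∪ posIndices k B, j ∈ Finset.Icc 1 k := fun j hj =>
    (Finset.mem_union.1 hj).elim (fun h => (mem_posIndices.1 h).1) fun h => (mem_posIndices.1 h).1
  have hJpos : ∀ j ∈ posIndices k β ∪ posIndices k B, 0 < β j + B j := fun j hj =>
    (Finset.mem_union.1 hj).elim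
      (fun h => add_pos_of_pos_of_nonneg (mem_posIndices.1 h).2 (hB j (hJk j hj)))
      fun h => add_pos_of_nonneg_of_pos (hβ j (hJk j hj)) (mem_posIndices.1 h).2
  obtain ⟨j₁, hj₁, hmin⟩ := Finset.exists_min_image (posIndices k β ∪ posIndices k B)
    (fun j => β j + B j) ⟨j₀, Finset.mem_union_right _ hj₀⟩
  set q := min 1 (min m c)
  have hq : 0 < q := lt_min one_pos (lt_min hm hcpos)
  have hq1 : q ≤ 1 := min_le_left _ _
  have hqm : q ≤ m := (min_le_right _ _).trans (min_le_left _ _)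
  have hqc : q ≤ c := (min_le_right _ _).trans (min_le_right _ _)
  set Q := 1 + M + c
  have hxQ : ∀ n, 2 * k ≤ n → ∀ i ∈ Finset.Icc 1 k,
      q ≤ x (n - i) ∧ x (n - i) ≤ Q ∧ 0 < x (n - i) := fun n hn i hi => by
    rw [Finset.mem_Icc] at hi
    have h1 := hbd (n - i) (by omega)
    exact ⟨hqm.trans h1.1, by simp only [Q]; linarith, hxpos _ (by omega)⟩
  set p : ℕ → ℕ → ℝ := fun n i =>
    if Even (n / g) then β i + B i * x (n - i) else β i * x (n - i) + c * B i with hp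
  have hplo : ∀ n, 2 * k ≤ n → ∀ i ∈ Finset.Icc 1 k, (β i + B i) * q ≤ p n i := by
    intro n hn i hi
    have h1 := hxQ n hn i hi
    simp only [hp]
    split_ifs
    · nlinarith [mul_le_mul_of_nonneg_left h1.1 (hB i hi), mul_le_mul_of_nonneg_left hq1 (hβ i hi)]
    · nlinarith [mul_le_mul_of_nonneg_left h1.1 (hβ i hi), mul_le_mul_of_nonneg_left hqc (hB i hi)]
  have hphi : ∀ n, 2 * k ≤ n → ∀ i ∈ Finset.Icc 1 k, p n i ≤ (β i + B i) * Q := by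
    intro n hn i hi
    have h1 := hxQ n hn i hi
    have hQ1 : 1 ≤ Q := by simp only [Q]; linarith
    have hQc : c ≤ Q := by simp only [Q]; linarith
    simp only [hp]
    split_ifs
    · nlinarith [mul_le_mul_of_nonneg_left h1.2.1 (hB i hi),
        mul_le_mul_of_nonneg_left hQ1 (hβ i hi)]
    · nlinarith [mul_le_mul_of_nonneg_left h1.2.1 (hβ i hi),
        mul_le_mul_of_nonneg_left hQc (hB i hi)]
  have hw : 0 < (β j₁ + B j₁) * q := mul_pos (hJpos j₁ hj₁) hq
  have hW : 0 < ∑ i ∈ Finset.Icc 1 k, (β i + B i) * Q := by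
    refine (mul_pos (hJpos j₁ hj₁) (show 0 < Q by simp only [Q]; linarith)).trans_le ?_
    refine Finset.single_le_sum (f := fun i => (β i + B i) * Q) (fun i hi => ?_) (hJk j₁ hj₁)
    exact mul_nonneg (add_nonneg (hβ i hi) (hB i hi)) (by simp only [Q]; linarith)
  refine ⟨_, div_pos hw hW, averages_of_weights (p := p) hw (fun j hj => hJk j hj) ⟨j₁, hj₁⟩
    (fun n hn i hi => (mul_nonneg (add_nonneg (hβ i hi) (hB i hi)) hq.le).trans (hplo n hn i hi))
    (fun n hn i hi hiJ => ?_)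
    (fun n hn j hj => (mul_le_mul_of_nonneg_right (hmin j hj) hq.le).trans
      (hplo n hn j (hJk j hj)))
    (fun n hn => Finset.sum_le_sum (hphi n hn)) fun n hn => ?_⟩
  · have h1 : β i = 0 := (hβ i hi).antisymm' (not_lt.1 fun h =>
      hiJ (Finset.mem_union_left _ (mem_posIndices.2 ⟨hi, h⟩)))
    have h2 : B i = 0 := (hB i hi).antisymm' (not_lt.1 fun h =>
      hiJ (Finset.mem_union_right _ (mem_posIndices.2 ⟨hi, h⟩)))
    simp [hp, h1, h2]
  · obtain ⟨l, rfl⟩ : ∃ l, n = l + k := ⟨n - k, by omega⟩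
    have heq := hx.mul_denom l
    have hxn := hxpos (l + k) (by omega)
    have hparβ : ∀ i ∈ Finset.Icc 1 k, β i ≠ 0 →
        (Even ((l + k - i) / g) ↔ Even ((l + k) / g)) := fun i hi h =>
      even_sub_div_iff hg (hdvdβ i (mem_posIndices.2 ⟨hi, (hβ i hi).lt_of_ne' h⟩)) (by
        rw [Finset.mem_Icc] at hi; omega)
    have hparB : ∀ i ∈ Finset.Icc 1 k, B i ≠ 0 →
        (Even ((l + k - i) / g) ↔ ¬ Even ((l + k) / g)) := fun i hi h =>
      even_sub_div_iff_not hg (hdvdB i (mem_posIndices.2 ⟨hi, (hB i hi).lt_of_ne' h⟩)) (by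
        rw [Finset.mem_Icc] at hi; omega)
    by_cases hev : Even ((l + k) / g)
    · have hR : ∑ i ∈ Finset.Icc 1 k, p (l + k) i *
          (if Even ((l + k - i) / g) then x (l + k - i) else c / x (l + k - i)) =
          ∑ i ∈ Finset.Icc 1 k, (β i * x (l + k - i) + B i * c) := by
        refine Finset.sum_congr rfl fun i hi => ?_
        have hxi := (hxQ (l + k) hn i hi).2.2.ne'
        simp only [hp, if_pos hev]
        by_cases h1 : β i = 0
        · by_cases h2 : B i = 0
          · simp [h1, h2]
          · rw [if_neg (fun h => (hparB i hi h2).1 h hev), h1]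
            field_simp
            ring
        · have h2 : B i = 0 := by
            by_contra h2
            exact (hparB i hi h2).1 ((hparβ i hi h1).2 hev) hev
          rw [if_pos ((hparβ i hi h1).2 hev), h2]
          ring
      rw [hR, if_pos hev]
      simp only [hp, if_pos hev]
      rw [Finset.sum_add_distrib, Finset.sum_add_distrib, ← Finset.sum_mul, heq, hc, add_comm]
    · have hR : ∑ i ∈ Finset.Icc 1 k, p (l + k) i *
          (if Even ((l + k - i) / g) then x (l + k - i) else c / x (l + k - i)) =
          ∑ i ∈ Finset.Icc 1 k, (c * β i + c * (B i * x (l + k - i))) := by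
        refine Finset.sum_congr rfl fun i hi => ?_
        have hxi := (hxQ (l + k) hn i hi).2.2.ne'
        simp only [hp, if_neg hev]
        by_cases h1 : β i = 0
        · by_cases h2 : B i = 0
          · simp [h1, h2]
          · rw [if_pos ((hparB i hi h2).2 hev), h1]
            ring
        · have h2 : B i = 0 := by
            by_contra h2
            exact hev ((hparβ i hi h1).1 ((hparB i hi h2).2 hev))
          rw [if_neg (fun h => hev ((hparβ i hi h1).1 h)), h2]
          field_simp
          ring
      have hnum : ∑ i ∈ Finset.Icc 1 k, β i * x (l + k - i) + c * ∑ i ∈ Finset.Icc 1 k, B i =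
          x (l + k) * (∑ i ∈ Finset.Icc 1 k, β i +
            ∑ j ∈ Finset.Icc 1 k, B j * x (l + k - j)) := by
        rw [heq, ← hc]
        ring
      rw [hR, if_neg hev]
      simp only [hp, if_neg hev]
      rw [Finset.sum_add_distrib, Finset.sum_add_distrib, ← Finset.mul_sum, ← Finset.mul_sum,
        ← Finset.mul_sum, ← mul_add, hnum, ← mul_assoc, div_mul_cancel₀ _ hxn.ne']

theorem exists_periodic_asymptotics {x : ℕ → ℝ} (hα : 0 < α)
    (hβ : ∀ i ∈ Finset.Icc 1 k, 0 ≤ β i) (hB : ∀ j ∈ Finset.Icc 1 k, 0 ≤ B j)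
    (hBsum : 0 < ∑ j ∈ Finset.Icc 1 k, B j) (hg : 0 < g)
    (hdvdβ : ∀ i ∈ posIndices k β, 2 * g ∣ i) (hdvdB : ∀ j ∈ posIndices k B, 2 * g ∣ j + g)
    (hgcd : ∀ d, (∀ j ∈ posIndices k β ∪ posIndices k B, d ∣ j) → d ∣ g)
    (hx : IsSolution k α (∑ i ∈ Finset.Icc 1 k, β i) β B x) :
    ∃ y : ℕ → ℝ, IsSolution k α (∑ i ∈ Finset.Icc 1 k, β i) β B y ∧ HasPeriod y (2 * g) ∧
      Tendsto (fun n => x n - y n) atTop (𝓝 0) := by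
  obtain ⟨c, hc⟩ : ∃ c, (∑ j ∈ Finset.Icc 1 k, B j) * c = α :=
    ⟨α / _, mul_div_cancel₀ _ hBsum.ne'⟩
  have hcpos : 0 < c := pos_of_mul_pos_right (hc ▸ hα) hBsum.le
  obtain ⟨m, M, hm, hM, hmM, hbd⟩ := hx.exists_bounds hα hβ hB hBsum hc
  obtain ⟨ε, hε, hav⟩ := hx.averages hβ hB hBsum hg hdvdβ hdvdB hc hcpos hm hbd
  have hxpos : ∀ n, k ≤ n → 0 < x n := fun n hn => hm.trans_le (hbd n hn).1
  choose L hL using hav.exists_tendsto_residue (K := k) hε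
    (fun j hj => by
      have : j ∈ Finset.Icc 1 k := (Finset.mem_union.1 (Finset.mem_coe.1 hj)).elim
        (fun h => (mem_posIndices.1 h).1) fun h => (mem_posIndices.1 h).1
      rw [Finset.mem_Icc] at this
      omega)
    hg
    (fun j hj => (Finset.mem_union.1 (Finset.mem_coe.1 hj)).elim
      (fun h => (dvd_mul_left g 2).trans (hdvdβ j h)) fun h => dvd_of_two_mul_dvd_add (hdvdB j h))
    hgcd (by omega)
  set u : ℕ → ℝ := fun n => if Even (n / g) then x n else c / x n with hu
  have hmu : ∀ n, k ≤ n → m ≤ u n := fun n hn => by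
    simp only [hu]
    split_ifs
    · exact (hbd n hn).1
    · rw [le_div_iff₀ (hxpos n hn), ← hmM]
      exact mul_le_mul_of_nonneg_left (hbd n hn).2 hm.le
  have hmL : ∀ r, m ≤ L r := fun r => by
    refine ge_of_tendsto (hL r) (eventually_atTop.2 ⟨k, fun t ht => hmu _ ?_⟩)
    have : t ≤ g * t := Nat.le_mul_of_pos_left t hg
    omega
  have hLpos : ∀ r, 0 < L r := fun r => hm.trans_le (hmL r)
  refine ⟨alternating g c L, isSolution_alternating hα hβ hB hBsum hg hdvdβ hdvdB hc hLpos,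
    hasPeriod_alternating hg c L, ?_⟩
  have hlim : Tendsto (fun n => u n - L (n % g)) atTop (𝓝 0) := by
    refine tendsto_of_residues hg fun r hr => ?_
    have h1 : ∀ t, (r + g * t) % g = r := fun t => by
      rw [Nat.add_mul_mod_self_left, Nat.mod_eq_of_lt hr]
    simp only [h1]
    simpa using (hL r).sub_const (L r)
  have hlim' : Tendsto (fun n => (1 + c / (m * m)) * |u n - L (n % g)|) atTop (𝓝 0) := by
    simpa using hlim.abs.const_mul (1 + c / (m * m))
  refine squeeze_zero_norm' (eventually_atTop.2 ⟨k, fun n hn => ?_⟩) hlim'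
  have hcm : 0 ≤ c / (m * m) := by positivity
  rw [Real.norm_eq_abs]
  unfold alternating
  by_cases hev : Even (n / g)
  · simp only [hu, if_pos hev]
    exact le_mul_of_one_le_left (abs_nonneg _) (by linarith)
  · have h1 := hmu n hn
    have h2 := hmL (n % g)
    simp only [hu, if_neg hev] at h1 ⊢
    have hxn := hxpos n hn
    have hLn := hLpos (n % g)
    have hun : 0 < c / x n := div_pos hcpos hxn
    have h3 : x n - c / L (n % g) =
        -(c / (c / x n * L (n % g)) * (c / x n - L (n % g))) := by
      field_simp
      ring
    rw [h3, abs_neg, abs_mul, abs_of_pos (by positivity)]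
    refine mul_le_mul_of_nonneg_right ?_ (abs_nonneg _)
    have h4 : c / (c / x n * L (n % g)) ≤ c / (m * m) :=
      div_le_div_of_nonneg_left hcpos.le (by positivity) (mul_le_mul h1 h2 hm.le hun.le)
    linarith

end Main

end RationalDiff

open RationalDiff in
theorem theorem2 (k : ℕ) (α A : ℝ) (β B : ℕ → ℝ)
    (hα : 0 < α) (hA : 0 ≤ A)
    (hβ : ∀ i ∈ Finset.Icc 1 k, 0 ≤ β i)
    (hB : ∀ j ∈ Finset.Icc 1 k, 0 ≤ B j)
    (hBsum : 0 < ∑ j ∈ Finset.Icc 1 k, B j)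
    (hdvdβ : ∀ i ∈ RationalDiff.posIndices k β, 2 * RationalDiff.delayGcd k β B ∣ i)
    (hdvdB : ∀ j ∈ RationalDiff.posIndices k B,
      2 * RationalDiff.delayGcd k β B ∣ j + RationalDiff.delayGcd k β B) :
    (∑ i ∈ Finset.Icc 1 k, β i < A →
      ∃ e : ℝ, RationalDiff.IsEquilibrium k α A β B e ∧
        (∀ e' : ℝ, RationalDiff.IsEquilibrium k α A β B e' → e' = e) ∧
        RationalDiff.IsGloballyAsymptoticallyStable k α A β B e) ∧
    (A = ∑ i ∈ Finset.Icc 1 k, β i →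
      (∀ x : ℕ → ℝ, RationalDiff.IsSolution k α A β B x →
        ∃ y : ℕ → ℝ, RationalDiff.IsSolution k α A β B y ∧
          RationalDiff.HasPeriod y (2 * RationalDiff.delayGcd k β B) ∧
          Tendsto (fun n => x n - y n) atTop (𝓝 0)) ∧
      (∃ y : ℕ → ℝ, RationalDiff.IsSolution k α A β B y ∧
        RationalDiff.HasPrimePeriod y (2 * RationalDiff.delayGcd k β B))) ∧
    (A < ∑ i ∈ Finset.Icc 1 k, β i →
      ∃ x : ℕ → ℝ, RationalDiff.IsSolution k α A β B x ∧
        ¬ Bornology.IsBounded (Set.range x)) := by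
  have hg := delayGcd_pos (β := β) hBsum
  refine ⟨fun hlt => ?_, ?_, fun hlt => ?_⟩
  · obtain ⟨e, he, heq⟩ := exists_quadratic_root hα hBsum hlt
    refine ⟨e, (isEquilibrium_iff hα hA hBsum e).2 ⟨he.le, heq⟩, fun e' he' => ?_,
      isLocallyStable_of_lt hβ hB hBsum hlt he heq,
      isGlobalAttractor_of_lt hα hA hβ hB hBsum hlt he heq⟩
    obtain ⟨h0, h1⟩ := (isEquilibrium_iff hα hA hBsum e').1 he'
    exact quadratic_root_unique hBsum hlt he.le h0 heq h1
  · rintro rfl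
    refine ⟨fun x hx => exists_periodic_asymptotics hα hβ hB hBsum hg hdvdβ hdvdB
      (fun d hd => Finset.dvd_gcd hd) hx, ?_⟩
    obtain ⟨f, hf, hper⟩ := exists_hasPrimePeriod_alternating (div_pos hα hBsum) hg
    exact ⟨_, isSolution_alternating hα hβ hB hBsum hg hdvdβ hdvdB
      (mul_div_cancel₀ _ hBsum.ne') hf, hper⟩
  · exact exists_unbounded_solution hα hA hβ hB hBsum hg hdvdβ hdvdB hlt
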